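/- **Conventions.** A strict partition is a sequence $\lambda_1>\lambda_2>\dots>\lambda_r\ge 0$ (put $\lambda_i=0$ for $i>r$); its shifted diagram is $SD(\lambda)=\{(i,j): i\ge 1,\ i\le j\le \lambda_i+i-1\}$, drawn with rows numbered downwards. A corner of $\lambda$ is a box of $SD(\lambda)$ with no box of $SD(\lambda)$ directly below or directly to the right. For strict partitions with $\mu_i\le\lambda_i$ for all $i$, put $SD(\lambda/\mu)=SD(\lambda)\setminus SD(\mu)$. For a totally ordered set $B$, let $B'=\{k',k : k\in B\}$ with $|k|=|k'|=k$, ordered by $a<b$ if $|a|<|b|$, and $k'<k$. Write $a\leftarrow b$ if $a<b$ or $a=b$ is unmarked, and $a\Leftarrow b$ if $a<b$ or $a=b$ is marked. $\mathrm{QSST}(\lambda/\mu)$ is the set of fillings of $SD(\lambda/\mu)$ with letters of $\mathbb N'$, $\mathbb N=\{1,2,\dots\}$, which weakly increase along rows and columns and have, for each $k$, at most one $k'$ in each row and at most one $k$ in each column. For $L\in\mathrm{QSST}(\lambda/\mu)$ the tableau $\tilde L=\phi_T(L)$ has the same shape and has entries in $\tilde{\mathbb N}'$, where $\tilde{\mathbb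 N}=\{k_l : k,l\in\mathbb N\}$ is ordered lexicographically in $(k,l)$: for each $k$, the entries $k'$ and $k$ of $L$ receive the subscripts $1,2,3,\dots$, first the entries $k'$ from top to bottom, then the entries $k$ from left to right. A *slide* on a tableau of shape $\lambda/\mu$ puts a dot into a corner of $\mu$ and repeats elementary slides until the dot is in a corner of $\lambda$, whose box is then removed. In an elementary slide, with $a$ the entry below the dot and $b$ the entry to its right, the dot changes places with $a$ if $a\leftarrow b$ or $b$ is missing, and with $b$ if $b\Leftarrow a$ or $a$ is missing; except that if the dot is in $(i,i)$, the box $(i,i+1)$ holds $k'$ and $(i+1,i+1)$ holds $c\in\{k,k'\}$, then $c$ is put into $(i,i)$, $k$ into $(i,i+1)$, and the dot into $(i+1,i+1)$. *Jeu de taquin* performs slides, from arbitrarily chosen inside corners, until the inner shape is empty; a resulting tableau, of normal shape, is a rectification $\mathrm{Rect}(\tilde L)$ of $\tilde L$. **Lemma.** Let $\lambda/\mu$ be a skew strict partition, $L\in \mathrm{QSST}(\lambda/\mu)$ and $\tilde L=(\tilde l_{ij})=\phi_T(L)$. Put $m=\min\{\lambda_2,\sum_{i\ge2}(\lambda_i-\mu_i)\}$.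 Then $\tilde L$ can be rectified by jeu de taquin, and for every choice of the slides, if $\nu$ is the shape of the resulting tableau $\mathrm{Rect}(\tilde L)$, the entries $\tilde l_{1,m+\mu_1+1},\dots,\tilde l_{1,\lambda_1}$ (the shifted arm, possibly empty) are placed in the boxes $(1,m+\mu_1-\lambda_1+\nu_1+1),\dots,(1,\nu_1)$ of $\mathrm{Rect}(\tilde L)$, respectively. That is, for every $j$ with $m+\mu_1+1\le j\le\lambda_1$ one has $j-\lambda_1+\nu_1\ge1$, and the entry of $\mathrm{Rect}(\tilde L)$ in the box $(1,\,j-\lambda_1+\nu_1)$ is $\tilde l_{1,j}$. -/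

import Mathlib

/-- A strict partition `lam_1 > lam_2 > ⋯ > lam_r ≥ 0`, extended by zeros. Rows are numbered from
`1`; the value at index `0` carries no information and is fixed to be `0`. -/
@[ext]
structure StrictPartition where
  part : ℕ → ℕ
  part_zero : part 0 = 0
  strict : ∀ i, 1 ≤ i → part (i + 1) < part i ∨ (part i = 0 ∧ part (i + 1) = 0)

namespace StrictPartition

/-- The shifted diagram `{(i, j) : 1 ≤ i, i ≤ j ≤ lam_i + i - 1}`. -/
def diagram (lam : StrictPartition) : Set (ℕ × ℕ) :=
  {p | 1 ≤ p.1 ∧ p.1 ≤ p.2 ∧ p.2 < lam.part p.1 + p.1}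

/-- The corners of a shifted diagram: boxes with no box below and no box to the right. -/
def corners (lam : StrictPartition) : Set (ℕ × ℕ) :=
  {p | p ∈ lam.diagram ∧ (p.1 + 1, p.2) ∉ lam.diagram ∧ (p.1, p.2 + 1) ∉ lam.diagram}

theorem part_add_le (lam : StrictPartition) (i : ℕ) :
    lam.part (i + 1) = 0 ∨ lam.part (i + 1) + i ≤ lam.part 1 := by
  induction i with
  | zero => right; simp
  | succ i ih =>
    have h := lam.strict (i + 1) (by omega)
    omega

/-- Only finitely many parts are non-zero, so that sums of parts are honest finite sums. -/
theorem part_eq_zero_of_lt (lam : StrictPartition) {i : ℕ} (h : lam.part 1 < i) :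
    lam.part i = 0 := by
  obtain ⟨k, rfl⟩ : ∃ k, i = k + 1 := ⟨i - 1, by omega⟩
  have := lam.part_add_le k
  omega

theorem finite_support_sub (lam mu : StrictPartition) :
    (Function.support fun i : ℕ => lam.part (i + 2) - mu.part (i + 2)).Finite := by
  refine (Set.finite_Iio (lam.part 1)).subset fun i hi => ?_
  by_contra h
  simp only [Set.mem_Iio, not_lt] at h
  exact hi (by simp [lam.part_eq_zero_of_lt (show lam.part 1 < i + 2 by omega)])

end StrictPartition

/-- The number `min {lam_2, ∑_{i ≥ 2} (lam_i - mu_i)}`. -/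
noncomputable def armOffset (lam mu : StrictPartition) : ℕ :=
  min (lam.part 2) (∑ᶠ i : ℕ, (lam.part (i + 2) - mu.part (i + 2)))

/-- The alphabet `B'` of marked and unmarked copies of the elements of `B`, with the order
`1' < 1 < 2' < 2 < ⋯`: the pair `(k, false)` is the marked letter `k'` and `(k, true)` is the
unmarked letter `k`. -/
abbrev Letter (B : Type) := B ×ₗ Bool

namespace Letter

variable {B : Type}

/-- The unmarked letter `k`. -/
def plain (k : B) : Letter B := toLex (k, true)

/-- The marked letter `k'`. -/
def prime (k : B) : Letter B := toLex (k, false)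

/-- `|k| = |k'| = k`. -/
def abs (a : Letter B) : B := (ofLex a).1

/-- `a` is a marked letter. -/
def IsMarked (a : Letter B) : Prop := (ofLex a).2 = false

/-- The relation `a ← b`: `a < b`, or `a = b` is unmarked. -/
def LeftArrow [LinearOrder B] (a b : Letter B) : Prop := a < b ∨ (a = b ∧ ¬ a.IsMarked)

/-- The relation `a ⇐ b`: `a < b`, or `a = b` is marked. -/
def LeftDoubleArrow [LinearOrder B] (a b : Letter B) : Prop := a < b ∨ (a = b ∧ a.IsMarked)

end Letter

/-- A skew shifted tableau of shape `outer / inner` with entries in `A`; boxes outside of the skew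
diagram have the value `none`. -/
@[ext]
structure SkewTableau (A : Type) where
  outer : StrictPartition
  inner : StrictPartition
  le : ∀ i, inner.part i ≤ outer.part i
  entry : ℕ × ℕ → Option A
  isSome_iff : ∀ p, (entry p).isSome ↔ p ∈ outer.diagram \ inner.diagram

/-- The skew shifted tableaux over `B'` whose entries weakly increase along rows and columns, with
at most one `k'` in each row and at most one `k` in each column, for each `k`. -/
structure SkewTableau.IsQSST {B : Type} [LinearOrder B] (T : SkewTableau (Letter B)) : Prop where
  row_le : ∀ i j j' a b, j ≤ j' → T.entry (i, j) = some a → T.entry (i, j') = some b → a ≤ b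
  col_le : ∀ i i' j a b, i ≤ i' → T.entry (i, j) = some a → T.entry (i', j) = some b → a ≤ b
  row_marked : ∀ k i j j', T.entry (i, j) = some (Letter.prime k) →
    T.entry (i, j') = some (Letter.prime k) → j = j'
  col_unmarked : ∀ k i i' j, T.entry (i, j) = some (Letter.plain k) →
    T.entry (i', j) = some (Letter.plain k) → i = i'

/-- One elementary slide. A state is a partial filling of the plane together with the position of
the dot (the box of the dot itself holds no letter). -/
inductive ElementarySlide {B : Type} [LinearOrder B] :
    (ℕ × ℕ → Option (Letter B)) × (ℕ × ℕ) → (ℕ × ℕ → Option (Letter B)) × (ℕ × ℕ) → Prop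
  /-- The entry `a` below the dot moves up if `a ← b` for the entry `b` to the right of the dot,
  or if there is no entry to the right. -/
  | up (F : ℕ × ℕ → Option (Letter B)) (i j : ℕ) (a : Letter B)
      (ha : F (i + 1, j) = some a)
      (hb : ∀ b, F (i, j + 1) = some b → a.LeftArrow b) :
      ElementarySlide (F, (i, j))
        (Function.update (Function.update F (i, j) (some a)) (i + 1, j) none, (i + 1, j))
  /-- The entry `b` to the right of the dot moves left if `b ⇐ a` for the entry `a` below the dot,
  or if there is no entry below, unless the exceptional case applies. -/
  | left (F : ℕ × ℕ → Option (Letter B)) (i j : ℕ) (b : Letter B)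
      (hb : F (i, j + 1) = some b)
      (ha : ∀ a, F (i + 1, j) = some a → b.LeftDoubleArrow a)
      (hexc : ¬ (i = j ∧ b.IsMarked ∧ ∃ c, F (i + 1, j + 1) = some c ∧ c.abs = b.abs)) :
      ElementarySlide (F, (i, j))
        (Function.update (Function.update F (i, j) (some b)) (i, j + 1) none, (i, j + 1))
  /-- The exceptional case: the dot is in the diagonal box `(i, i)`, the box `(i, i + 1)` holds
  `k'`, and the box `(i + 1, i + 1)` holds a letter `c` which is `k` or `k'`. Then `c` is put into
  `(i, i)`, `k` is put into `(i, i + 1)`, and the dot moves to `(i + 1, i + 1)`. -/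
  | exceptional (F : ℕ × ℕ → Option (Letter B)) (i : ℕ) (k : B) (c : Letter B)
      (hb : F (i, i + 1) = some (Letter.prime k))
      (hc : F (i + 1, i + 1) = some c) (hck : c = Letter.plain k ∨ c = Letter.prime k) :
      ElementarySlide (F, (i, i))
        (Function.update (Function.update (Function.update F (i, i) (some c))
          (i, i + 1) (some (Letter.plain k))) (i + 1, i + 1) none, (i + 1, i + 1))

namespace SkewTableau

variable {B : Type} [LinearOrder B]

/-- `T'` arises from `T` by a slide: a dot is put into an inside corner `c` (a corner of the inner
shape), elementary slides are repeated until the dot is in an outside corner `d` (a corner of the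
outer shape), and then the box `d` is removed. -/
def IsSlide (T T' : SkewTableau (Letter B)) : Prop :=
  ∃ c ∈ T.inner.corners, ∃ d ∈ T.outer.corners,
    Relation.ReflTransGen ElementarySlide (T.entry, c) (T'.entry, d) ∧
    T'.inner.diagram = T.inner.diagram \ {c} ∧
    T'.outer.diagram = T.outer.diagram \ {d}

/-- `R` is obtained from `T` by jeu de taquin: slides are performed, into inside corners chosen
arbitrarily, until no inside corner is left, so that `R` has normal (non-skew) shape. -/
def IsRectification (T R : SkewTableau (Letter B)) : Prop :=
  Relation.ReflTransGen IsSlide T R ∧ ∀ i, R.inner.part i = 0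

/-- The subscript (minus one) which the labelling `phiT` gives to a letter `a = k'` or `a = k` in
the box `p`: first the entries `k'` are numbered from top to bottom, then the entries `k` are
numbered from left to right. -/
noncomputable def subscriptPred (L : SkewTableau (Letter ℕ+)) (p : ℕ × ℕ) (a : Letter ℕ+) : ℕ :=
  open Classical in
  if a.IsMarked then
    {q : ℕ × ℕ | L.entry q = some (Letter.prime a.abs) ∧ q.1 < p.1}.ncard
  else
    {q : ℕ × ℕ | L.entry q = some (Letter.prime a.abs)}.ncard +
      {q : ℕ × ℕ | L.entry q = some (Letter.plain a.abs) ∧ q.2 < p.2}.ncard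

/-- The labelling map `phi_T`: the entry `k` or `k'` receives a subscript `l ≥ 1` and becomes `k_l`
or `k'_l`. The letters `k_l` form the set `ℕ+ ×ₗ ℕ+`, ordered lexicographically. -/
noncomputable def phiT (L : SkewTableau (Letter ℕ+)) : SkewTableau (Letter (ℕ+ ×ₗ ℕ+)) where
  outer := L.outer
  inner := L.inner
  le := L.le
  entry p := (L.entry p).map fun a =>
    toLex (toLex (a.abs, (L.subscriptPred p a).succPNat), (ofLex a).2)
  isSome_iff p := by rw [Option.isSome_map]; exact L.isSome_iff p

end SkewTableau

/-! The dot only moves right or down; the letters merely decide which. Write m for `armOffset`, λ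
and μ for the current outer and inner shapes, and j for the current column of an arm entry. The
inequality m + μ_1 + 1 ≤ j survives every slide, and j - λ_1 stays constant (`IsSlide.arm`).

A slide starting below the first row never touches that row. One starting at (1, μ_1) can leave the
row only in a column t with (2, t) filled, and then t ≤ λ_2 + 1 < j. So either the dot drops out
before the arm and the entry stays, or it runs through the whole row, and j, λ_1 and μ_1 all drop by
one. Moreover m never grows: the number of boxes below the first row could increase only if the dot
started below that row and ended in it.

Rectifications exist because the coordinate sum of the dot increases within a finite diagram, and
each slide removes a box of the inner shape. -/

namespace StrictPartition

/-! ### Shifted diagrams and their corners. -/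

theorem finite_diagram (lam : StrictPartition) : lam.diagram.Finite := by
  refine ((Set.finite_Iic (lam.part 1)).prod (Set.finite_Iic (lam.part 1))).subset ?_
  rintro ⟨i, j⟩ ⟨h1, h2, h3⟩
  simp only [Set.mem_prod, Set.mem_Iic] at *
  obtain ⟨k, rfl⟩ : ∃ k, i = k + 1 := ⟨i - 1, by omega⟩
  have := lam.part_add_le k
  omega

theorem mem_diagram_of_le_row (lam : StrictPartition) {i j j' : ℕ} (hij : i ≤ j) (hjj : j ≤ j')
    (h : (i, j') ∈ lam.diagram) : (i, j) ∈ lam.diagram := by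
  obtain ⟨h1, h2, h3⟩ := h
  exact ⟨h1, hij, lt_of_le_of_lt hjj h3⟩

theorem mem_diagram_of_succ_row (lam : StrictPartition) {i j : ℕ} (hi : 1 ≤ i)
    (h : (i + 1, j) ∈ lam.diagram) : (i, j) ∈ lam.diagram := by
  obtain ⟨h1, h2, h3⟩ := h
  have := lam.strict i hi
  refine ⟨hi, ?_, ?_⟩ <;> simp only at * <;> omega

theorem diagram_mono {mu lam : StrictPartition} (h : ∀ i, mu.part i ≤ lam.part i) :
    mu.diagram ⊆ lam.diagram := fun _ hp =>
  ⟨hp.1, hp.2.1, hp.2.2.trans_le (Nat.add_le_add_right (h _) _)⟩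

theorem exists_corner (lam : StrictPartition) (h : lam.diagram.Nonempty) :
    lam.corners.Nonempty := by
  obtain ⟨p, hp, hmax⟩ :=
    Set.exists_max_image lam.diagram (fun p : ℕ × ℕ => p.1 + p.2) lam.finite_diagram h
  refine ⟨p, hp, fun h' => ?_, fun h' => ?_⟩
  · have := hmax _ h'
    simp only at this
    omega
  · have := hmax _ h'
    simp only at this
    omega

theorem diagram_eq_empty_iff (lam : StrictPartition) :
    lam.diagram = ∅ ↔ ∀ i, lam.part i = 0 := by
  rw [Set.eq_empty_iff_forall_notMem]
  constructor
  · intro h i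
    by_contra h0
    have hi : i ≠ 0 := fun hi => h0 (hi ▸ lam.part_zero)
    exact h (i, i) ⟨by simp only; omega, le_rfl, by simp only; omega⟩
  · rintro h ⟨i, j⟩ ⟨-, h2, h3⟩
    have := h i
    simp only at *
    omega

/-- A corner is the last box of its row, and the next row is shorter by at least two boxes unless
the corner lies on the diagonal. -/
theorem corner_spec (lam : StrictPartition) {c : ℕ × ℕ} (hc : c ∈ lam.corners) :
    1 ≤ c.1 ∧ 1 ≤ lam.part c.1 ∧ c.2 + 1 = lam.part c.1 + c.1 ∧
      (lam.part (c.1 + 1) + 2 ≤ lam.part c.1 ∨ (lam.part c.1 = 1 ∧ lam.part (c.1 + 1) = 0)) := by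
  obtain ⟨i, j⟩ := c
  obtain ⟨⟨h1, h2, h3⟩, h4, h5⟩ := hc
  have := lam.strict i h1
  simp only [diagram, Set.mem_ofPred_eq, not_and, not_lt] at *
  by_cases hij : i + 1 ≤ j
  · have := h4 (by omega) hij
    have := h5 h1 (by omega)
    omega
  · have := h5 h1 (by omega)
    omega

/-- The strict partition whose diagram arises by removing a corner. -/
def removeCorner (lam : StrictPartition) (c : ℕ × ℕ) (hc : c ∈ lam.corners) :
    StrictPartition where
  part := Function.update lam.part c.1 (lam.part c.1 - 1)
  part_zero := by
    have := (lam.corner_spec hc).1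
    rw [Function.update_of_ne (by omega), lam.part_zero]
  strict i hi := by
    obtain ⟨h1, h2, -, h3⟩ := lam.corner_spec hc
    have := lam.strict i hi
    rcases eq_or_ne i c.1 with rfl | hic
    · rw [Function.update_self, Function.update_of_ne (by omega)]
      omega
    · rw [Function.update_of_ne hic]
      rcases eq_or_ne (i + 1) c.1 with hic' | hic'
      · rw [hic', Function.update_self]
        rw [hic'] at this
        omega
      · rwa [Function.update_of_ne hic']

theorem diagram_removeCorner (lam : StrictPartition) (c : ℕ × ℕ) (hc : c ∈ lam.corners) :
    (lam.removeCorner c hc).diagram = lam.diagram \ {c} := by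
  obtain ⟨h1, h2, h3, -⟩ := lam.corner_spec hc
  obtain ⟨r, s⟩ := c
  ext ⟨i, j⟩
  simp only [removeCorner, diagram, Set.mem_ofPred_eq, Set.mem_sdiff, Set.mem_singleton_iff,
    Prod.mk.injEq, Function.update_apply] at *
  split_ifs with h
  · subst h
    omega
  · simp [h]

theorem part_of_diagram_eq_diff {lam lam' : StrictPartition} {c : ℕ × ℕ} (hc : c ∈ lam.corners)
    (h : lam'.diagram = lam.diagram \ {c}) (i : ℕ) :
    lam'.part i + (if i = c.1 then 1 else 0) = lam.part i := by
  obtain ⟨h1, h2, h3, -⟩ := lam.corner_spec hc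
  obtain ⟨r, s⟩ := c
  have key : ∀ j, (1 ≤ i ∧ i ≤ j ∧ j < lam'.part i + i) ↔
      (1 ≤ i ∧ i ≤ j ∧ j < lam.part i + i) ∧ ¬ (i = r ∧ j = s) := fun j => by
    simpa [diagram] using Set.ext_iff.1 h (i, j)
  simp only at *
  rcases Nat.eq_zero_or_pos i with rfl | hi
  · rw [lam.part_zero, lam'.part_zero, if_neg (by omega)]
  -- The last box of row `i` and the first position beyond it, for both shapes, determine the two
  -- row lengths.
  have k1 := key (lam'.part i + i)
  have k2 := key (lam.part i + i)
  have k3 := key (lam.part i + i - 1)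
  have k4 := key (lam'.part i + i - 1)
  split_ifs with hir
  · subst hir
    omega
  · omega

/-! ### The size of a skew diagram below its first row. -/

/-- The number of boxes of a skew diagram below the first row, as a sum over any long enough range
of rows. -/
theorem finsum_sub_eq_sum (lam mu : StrictPartition) {N : ℕ} (h : lam.part 1 ≤ N) :
    ∑ᶠ i : ℕ, (lam.part (i + 2) - mu.part (i + 2)) =
      ∑ i ∈ Finset.range N, (lam.part (i + 2) - mu.part (i + 2)) := by
  refine finsum_eq_sum_of_support_subset _ fun i hi => ?_
  by_contra h'
  simp only [Finset.coe_range, Set.mem_Iio, not_lt] at h'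
  exact hi (by simp [lam.part_eq_zero_of_lt (show lam.part 1 < i + 2 by omega)])

theorem part_two_sub_le_finsum (lam mu : StrictPartition) :
    lam.part 2 - mu.part 2 ≤ ∑ᶠ i : ℕ, (lam.part (i + 2) - mu.part (i + 2)) := by
  rw [finsum_sub_eq_sum lam mu (Nat.le_succ _)]
  exact Finset.single_le_sum (f := fun i => lam.part (i + 2) - mu.part (i + 2))
    (fun _ _ => Nat.zero_le _) (Finset.mem_range.2 (Nat.succ_pos _))

/-- The slide moves one box from the outer shape to the skew part's inner side: below the first row,
the box gained at `c` is paid for by the box lost at `d`. The only case with a net gain, `c` below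
the first row and `d` in it, is excluded by `hcd`. -/
theorem finsum_sub_le_of_corners {lam mu lam' mu' : StrictPartition} {c d : ℕ × ℕ}
    (hc : c ∈ mu.corners) (hd : d ∈ lam.corners) (hmu : mu'.diagram = mu.diagram \ {c})
    (hlam : lam'.diagram = lam.diagram \ {d}) (hle' : ∀ i, mu'.part i ≤ lam'.part i)
    (hle : ∀ i, mu.part i ≤ lam.part i) (hcd : c.1 = 1 ∨ 2 ≤ d.1) :
    ∑ᶠ i : ℕ, (lam'.part (i + 2) - mu'.part (i + 2)) ≤
      ∑ᶠ i : ℕ, (lam.part (i + 2) - mu.part (i + 2)) := by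
  have hl := part_of_diagram_eq_diff hd hlam
  have hm := part_of_diagram_eq_diff hc hmu
  have hN : lam'.part 1 ≤ lam.part 1 := by have := hl 1; omega
  -- Adding `d.1` to the range guarantees that it contains the index `d.1 - 2` of the row of `d`.
  rw [finsum_sub_eq_sum lam' mu' (N := lam.part 1 + d.1) (by omega),
    finsum_sub_eq_sum lam mu (N := lam.part 1 + d.1) (by omega)]
  rcases hcd with hc1 | hd2
  · refine Finset.sum_le_sum fun i _ => ?_
    have h1 := hl (i + 2)
    have h2 := hm (i + 2)
    rw [if_neg (by omega)] at h2
    omega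
  · have key : ∀ i ∈ Finset.range (lam.part 1 + d.1),
        lam'.part (i + 2) - mu'.part (i + 2) + (if i = d.1 - 2 then 1 else 0) =
          lam.part (i + 2) - mu.part (i + 2) + (if i + 2 = c.1 then 1 else 0) := fun i _ => by
      have h1 := hl (i + 2)
      have h2 := hm (i + 2)
      have h3 := hle (i + 2)
      have h4 := hle' (i + 2)
      split_ifs at * <;> omega
    have hsum := Finset.sum_congr rfl key
    rw [Finset.sum_add_distrib, Finset.sum_add_distrib, Finset.sum_ite_eq',
      if_pos (Finset.mem_range.2 (by omega))] at hsum
    have hle1 : ∑ i ∈ Finset.range (lam.part 1 + d.1), (if i + 2 = c.1 then 1 else 0) ≤ 1 := by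
      refine (Finset.sum_le_sum fun i _ => ?_).trans
        (Finset.sum_ite_eq' (Finset.range (lam.part 1 + d.1)) (c.1 - 2) (fun _ => 1)).le |>.trans ?_
      · split_ifs <;> omega
      · split_ifs <;> omega
    omega

end StrictPartition

/-! ### The first row during a slide. -/

namespace SkewTableau

variable {B : Type} [LinearOrder B]

/-- While the dot moves from the inside corner `c`, either it has already left the first row and
the entry in the box `(1, j)` is untouched, or it is still in the first row and has shifted the
entries that it passed by one box to the left. -/
def ArmInvariant (T : SkewTableau (Letter B)) (c : ℕ × ℕ) (j : ℕ)
    (s : (ℕ × ℕ → Option (Letter B)) × (ℕ × ℕ)) : Prop :=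
  (2 ≤ s.2.1 ∧ s.1 (1, j) = T.entry (1, j)) ∨
    (c.1 = 1 ∧ s.2.1 = 1 ∧ T.inner.part 1 ≤ s.2.2 ∧
      (∀ x, T.inner.part 1 ≤ x → x < s.2.2 → s.1 (1, x) = T.entry (1, x + 1)) ∧
      (∀ x, s.2.2 < x → s.1 (1, x) = T.entry (1, x)) ∧
      ∀ i x, 2 ≤ i → s.1 (i, x) = T.entry (i, x))

theorem armInvariant_init (T : SkewTableau (Letter B)) {c : ℕ × ℕ} (hc : c ∈ T.inner.corners)
    (j : ℕ) : ArmInvariant T c j (T.entry, c) := by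
  obtain ⟨h1, -, h3, -⟩ := T.inner.corner_spec hc
  by_cases h : c.1 = 1
  · rw [h] at h3
    exact Or.inr ⟨h, h, by simp only; omega, fun x hx hx' => by simp only at hx'; omega,
      fun _ _ => rfl, fun _ _ _ => rfl⟩
  · exact Or.inl ⟨by simp only; omega, rfl⟩

/-- A dot that can leave the first row in column `t` is to the left of the arm. -/
theorem lt_of_entry_two (T : SkewTableau (Letter B)) {c : ℕ × ℕ} (hc : c ∈ T.inner.corners)
    (hc1 : c.1 = 1) {j t : ℕ} (hj : armOffset T.outer T.inner + T.inner.part 1 + 1 ≤ j)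
    {a : Letter B} (ha : T.entry (2, t) = some a) : t < j := by
  obtain ⟨-, h2, -, h4⟩ := T.inner.corner_spec hc
  rw [hc1] at h2 h4
  rw [one_add_one_eq_two] at h4
  obtain ⟨⟨h5, h6, h7⟩, h8⟩ := (T.isSome_iff (2, t)).1 (by simp [ha])
  -- If the minimum is λ_2, then μ_1 ≥ 1 suffices. If it is the sum, it is at least λ_2 - μ_2, and
  -- `h4` bounds μ_1 - μ_2 below. Both give j ≥ λ_2 + 2 > t.
  have h9 := StrictPartition.part_two_sub_le_finsum T.outer T.inner
  simp only [StrictPartition.diagram, Set.mem_ofPred_eq, not_and, not_lt] at *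
  have := h8 (by omega) h6
  simp only [armOffset] at hj
  omega

/-- As long as the dot is in the first row, the lower rows are those of `T`, so `lt_of_entry_two`
applies to the letter that moves up. The exceptional slide from (1, 1) leaves in column 2. -/
theorem ArmInvariant.step {T : SkewTableau (Letter B)} {c : ℕ × ℕ} (hc : c ∈ T.inner.corners)
    {j : ℕ} (hj : armOffset T.outer T.inner + T.inner.part 1 + 1 ≤ j)
    {s s' : (ℕ × ℕ → Option (Letter B)) × (ℕ × ℕ)} (hs : ArmInvariant T c j s)
    (h : ElementarySlide s s') : ArmInvariant T c j s' := by
  cases h with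
  | up F i t a ha hb =>
    rcases hs with ⟨h1, h2⟩ | ⟨h1, h2, h3, h4, h5, h6⟩ <;> simp only at *
    · refine Or.inl ⟨by simp only; omega, ?_⟩
      simp only
      rw [Function.update_of_ne (by simp; omega), Function.update_of_ne (by simp; omega), h2]
    · subst h2
      have htj : t < j := T.lt_of_entry_two hc h1 hj (by rw [← h6 2 t le_rfl]; exact ha)
      refine Or.inl ⟨le_rfl, ?_⟩
      simp only
      rw [Function.update_of_ne (by simp), Function.update_of_ne (by simp; omega), h5 _ htj]
  | left F i t b hb ha hexc =>
    rcases hs with ⟨h1, h2⟩ | ⟨h1, h2, h3, h4, h5, h6⟩ <;> simp only at *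
    · refine Or.inl ⟨by simp only; omega, ?_⟩
      simp only
      rw [Function.update_of_ne (by simp; omega), Function.update_of_ne (by simp; omega), h2]
    · subst h2
      refine Or.inr ⟨h1, rfl, by simp only; omega, fun x hx hx' => ?_, fun x hx => ?_,
        fun i x hi => ?_⟩ <;> simp only at *
      · rw [Function.update_of_ne (by simp; omega)]
        rcases eq_or_ne x t with rfl | hxt
        · rw [Function.update_self, ← hb, h5 _ (by omega)]
        · rw [Function.update_of_ne (by simpa using hxt), h4 x hx (by omega)]
      · rw [Function.update_of_ne (by simp; omega), Function.update_of_ne (by simp; omega),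
          h5 _ (by omega)]
      · rw [Function.update_of_ne (by simp; omega), Function.update_of_ne (by simp; omega),
          h6 _ _ hi]
  | exceptional F i k b hb hb' hbk =>
    rcases hs with ⟨h1, h2⟩ | ⟨h1, h2, h3, h4, h5, h6⟩ <;> simp only at *
    · refine Or.inl ⟨by simp only; omega, ?_⟩
      simp only
      rw [Function.update_of_ne (by simp; omega), Function.update_of_ne (by simp; omega),
        Function.update_of_ne (by simp; omega), h2]
    · subst h2
      have hj2 : 2 < j := T.lt_of_entry_two hc h1 hj (by rw [← h6 2 2 le_rfl]; exact hb')
      refine Or.inl ⟨le_rfl, ?_⟩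
      simp only
      rw [Function.update_of_ne (by simp), Function.update_of_ne (by simp; omega),
        Function.update_of_ne (by simp; omega), h5 _ (by omega)]

/-- A slide keeps the arm at the end of the first row. -/
theorem IsSlide.arm {T T' : SkewTableau (Letter B)} (h : IsSlide T T') {j : ℕ}
    (hj : armOffset T.outer T.inner + T.inner.part 1 + 1 ≤ j) (hj' : j ≤ T.outer.part 1) :
    ∃ j', j' + T.outer.part 1 = j + T'.outer.part 1 ∧
      armOffset T'.outer T'.inner + T'.inner.part 1 + 1 ≤ j' ∧
      T'.entry (1, j') = T.entry (1, j) := by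
  obtain ⟨c, hc, d, hd, hr, hi, ho⟩ := h
  have hinv : ArmInvariant T c j (T'.entry, d) := by
    generalize (T'.entry, d) = s at hr
    induction hr with
    | refl => exact T.armInvariant_init hc j
    | tail _ h ih => exact ih.step hc hj h
  obtain ⟨d1, -, d3, -⟩ := T.outer.corner_spec hd
  have hl1 := StrictPartition.part_of_diagram_eq_diff hd ho 1
  have hl2 := StrictPartition.part_of_diagram_eq_diff hd ho 2
  have hm1 := StrictPartition.part_of_diagram_eq_diff hc hi 1
  have hsum : c.1 = 1 ∨ 2 ≤ d.1 := hinv.elim (fun h => Or.inr h.1) fun h => Or.inl h.1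
  have hn := StrictPartition.finsum_sub_le_of_corners hc hd hi ho T'.le T.le hsum
  simp only [armOffset] at hj ⊢
  rcases hinv with ⟨h1, h2⟩ | ⟨h1, h2, h3, h4, h5, -⟩
  · simp only at h1 h2
    rw [if_neg (by omega)] at hl1
    exact ⟨j, by omega, by omega, h2⟩
  · simp only at h2 h3 h4
    rw [if_pos h2.symm] at hl1
    rw [if_pos h1.symm] at hm1
    rw [h2] at d3
    -- The dot ended in column λ_1 ≥ j, hence it has passed column j.
    refine ⟨j - 1, by omega, by omega, ?_⟩
    rw [h4 (j - 1) (by omega) (by omega), Nat.sub_add_cancel (by omega)]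

theorem arm_of_reflTransGen {T R : SkewTableau (Letter B)}
    (h : Relation.ReflTransGen IsSlide T R) {j : ℕ}
    (hj : armOffset T.outer T.inner + T.inner.part 1 + 1 ≤ j) (hj' : j ≤ T.outer.part 1) :
    ∃ j', j' + T.outer.part 1 = j + R.outer.part 1 ∧
      armOffset R.outer R.inner + R.inner.part 1 + 1 ≤ j' ∧
      R.entry (1, j') = T.entry (1, j) := by
  induction h with
  | refl => exact ⟨j, rfl, hj, rfl⟩
  | tail _ h ih =>
    obtain ⟨j₁, h1, h2, h3⟩ := ih
    obtain ⟨j₂, h4, h5, h6⟩ := h.arm h2 (by omega)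
    exact ⟨j₂, by omega, h5, h6.trans h3⟩

/-! ### Existence of slides and rectifications. -/

/-- The boxes filled during a slide which started in the inside corner `c`. -/
def DotInvariant (T : SkewTableau (Letter B)) (c : ℕ × ℕ)
    (s : (ℕ × ℕ → Option (Letter B)) × (ℕ × ℕ)) : Prop :=
  s.2 ∈ T.outer.diagram ∧ (s.2 ∈ T.inner.diagram → s.2 = c) ∧
    ∀ p, (s.1 p).isSome ↔ p ∈ T.outer.diagram ∧ (p ∈ T.inner.diagram → p = c) ∧ p ≠ s.2

/-- The two arrows are complementary: if a ← b fails, then b ⇐ a. -/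
theorem exists_elementarySlide (F : ℕ × ℕ → Option (Letter B)) (i j : ℕ)
    (h : (F (i + 1, j)).isSome ∨ (F (i, j + 1)).isSome) :
    ∃ s, ElementarySlide (F, (i, j)) s := by
  rcases hb : F (i, j + 1) with _ | b
  · obtain ⟨a, ha⟩ := Option.isSome_iff_exists.1 (h.resolve_right (by simp [hb]))
    exact ⟨_, .up F i j a ha (by simp [hb])⟩
  by_cases hup : ∃ a, F (i + 1, j) = some a ∧ a.LeftArrow b
  · obtain ⟨a, ha, hab⟩ := hup
    exact ⟨_, .up F i j a ha fun b' hb' => by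
      rw [hb, Option.some_inj] at hb'
      exact hb' ▸ hab⟩
  by_cases hexc : i = j ∧ b.IsMarked ∧ ∃ c, F (i + 1, j + 1) = some c ∧ c.abs = b.abs
  · obtain ⟨rfl, hm, c, hcF, hcb⟩ := hexc
    refine ⟨_, .exceptional F i b.abs c ?_ hcF ?_⟩
    · rw [hb, Option.some_inj]
      exact Prod.ext rfl hm
    · rw [← hcb]
      rcases hc2 : (ofLex c).2 with _ | _
      · exact Or.inr (Prod.ext rfl hc2)
      · exact Or.inl (Prod.ext rfl hc2)
  · refine ⟨_, .left F i j b hb (fun a ha => ?_) hexc⟩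
    have hab : ¬ a.LeftArrow b := fun hab => hup ⟨a, ha, hab⟩
    rw [Letter.LeftArrow, not_or, not_lt] at hab
    rcases hab.1.lt_or_eq with hlt | heq
    · exact Or.inl hlt
    · exact Or.inr ⟨heq, by_contra fun hm => hab.2 ⟨heq.symm, heq ▸ hm⟩⟩

theorem DotInvariant.step {T : SkewTableau (Letter B)} {c : ℕ × ℕ}
    {s s' : (ℕ × ℕ → Option (Letter B)) × (ℕ × ℕ)} (hs : DotInvariant T c s)
    (h : ElementarySlide s s') :
    DotInvariant T c s' ∧ s.2.1 + s.2.2 < s'.2.1 + s'.2.2 := by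
  obtain ⟨h1, h2, h3⟩ := hs
  cases h with
  | up F i t a ha hb =>
    have h4 := (h3 (i + 1, t)).1 (by simp [ha])
    refine ⟨⟨h4.1, h4.2.1, fun p => ?_⟩, by simp only; omega⟩
    by_cases hp : p = (i + 1, t)
    · simp [hp]
    · by_cases hp' : p = (i, t)
      · subst hp'
        simpa [Function.update_apply] using ⟨h1, h2⟩
      · have := h3 p
        simp only [Function.update_apply, hp, hp', if_false] at this ⊢
        simpa [hp, hp'] using this
  | left F i t b hb ha hexc =>
    have h4 := (h3 (i, t + 1)).1 (by simp [hb])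
    refine ⟨⟨h4.1, h4.2.1, fun p => ?_⟩, by simp only; omega⟩
    by_cases hp : p = (i, t + 1)
    · simp [hp]
    · by_cases hp' : p = (i, t)
      · subst hp'
        simpa [Function.update_apply] using ⟨h1, h2⟩
      · have := h3 p
        simp only [Function.update_apply, hp, hp', if_false] at this ⊢
        simpa [hp, hp'] using this
  | exceptional F i k b hb hb' hbk =>
    have h4 := (h3 (i + 1, i + 1)).1 (by simp [hb'])
    have h5 := (h3 (i, i + 1)).1 (by simp [hb])
    refine ⟨⟨h4.1, h4.2.1, fun p => ?_⟩, by simp only; omega⟩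
    by_cases hp : p = (i + 1, i + 1)
    · simp [hp]
    · by_cases hp' : p = (i, i)
      · subst hp'
        simpa [Function.update_apply] using ⟨h1, h2⟩
      · by_cases hp'' : p = (i, i + 1)
        · subst hp''
          simpa [Function.update_apply] using ⟨h5.1, h5.2.1⟩
        · have := h3 p
          simp only [Function.update_apply, hp, hp', hp'', if_false] at this ⊢
          simpa [hp, hp'] using this

/-- The dot can be moved until it reaches an outside corner. -/
theorem DotInvariant.exists_corner {T : SkewTableau (Letter B)} {c : ℕ × ℕ}
    (hc : c ∈ T.inner.corners) {s : (ℕ × ℕ → Option (Letter B)) × (ℕ × ℕ)}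
    (hs : DotInvariant T c s) :
    ∃ s', Relation.ReflTransGen ElementarySlide s s' ∧ DotInvariant T c s' ∧
      s'.2 ∈ T.outer.corners := by
  obtain ⟨N, hN⟩ : ∃ N, ∀ p ∈ T.outer.diagram, p.1 + p.2 ≤ N := by
    obtain ⟨N, hN⟩ := (T.outer.finite_diagram.image fun p => p.1 + p.2).bddAbove
    exact ⟨N, fun p hp => hN (Set.mem_image_of_mem _ hp)⟩
  induction hk : N - (s.2.1 + s.2.2) using Nat.strong_induction_on generalizing s with
  | _ k ih =>
    by_cases hcor : s.2 ∈ T.outer.corners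
    · exact ⟨s, .refl, hs, hcor⟩
    obtain ⟨F, i, j⟩ := s
    have hs' := hs
    obtain ⟨h1, h2, h3⟩ := hs
    have hij : 1 ≤ i ∧ i ≤ j := ⟨h1.1, h1.2.1⟩
    have hsome : (F (i + 1, j)).isSome ∨ (F (i, j + 1)).isSome := by
      -- A neighbour in the outer shape can be empty only if it is in the inner shape. Then so is
      -- the dot, which is thus at `c`, contradicting that `c` is an inner corner.
      by_contra! hno
      refine hcor ⟨h1, fun hb => hno.1 ?_, fun hr => hno.2 ?_⟩
      · refine (h3 _).2 ⟨hb, fun hin => ?_, by simp⟩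
        have := h2 (T.inner.mem_diagram_of_succ_row hij.1 hin)
        exact absurd hin (this ▸ hc).2.1
      · refine (h3 _).2 ⟨hr, fun hin => ?_, by simp⟩
        have := h2 (T.inner.mem_diagram_of_le_row hij.2 (Nat.le_succ j) hin)
        exact absurd hin (this ▸ hc).2.2
    obtain ⟨s₁, hstep⟩ := exists_elementarySlide F i j hsome
    obtain ⟨hinv, hlt⟩ := hs'.step hstep
    have hb := hN _ hinv.1
    obtain ⟨s', h4, h5, h6⟩ := ih _ (by omega) hinv rfl
    exact ⟨s', .head hstep h4, h5, h6⟩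

theorem exists_isSlide (T : SkewTableau (Letter B)) {c : ℕ × ℕ} (hc : c ∈ T.inner.corners) :
    ∃ T', IsSlide T T' ∧ T'.inner.diagram = T.inner.diagram \ {c} := by
  have hsub := StrictPartition.diagram_mono T.le
  have h0 : DotInvariant T c (T.entry, c) := by
    refine ⟨hsub hc.1, fun _ => rfl, fun p => ?_⟩
    rw [T.isSome_iff]
    exact ⟨fun h => ⟨h.1, fun h' => absurd h' h.2, fun h' => h.2 (h' ▸ hc.1)⟩,
      fun h => ⟨h.1, fun h' => h.2.2 (h.2.1 h')⟩⟩
  obtain ⟨⟨F, d⟩, hr, ⟨h1, h2, h3⟩, hd⟩ := h0.exists_corner hc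
  simp only at h1 h2 h3 hd
  have hi := T.inner.diagram_removeCorner c hc
  have ho := T.outer.diagram_removeCorner d hd
  refine ⟨⟨T.outer.removeCorner d hd, T.inner.removeCorner c hc, fun i => ?_, F, fun p => ?_⟩,
    ⟨c, hc, d, hd, hr, hi, ho⟩, hi⟩
  · have hl := StrictPartition.part_of_diagram_eq_diff hd ho i
    have hm := StrictPartition.part_of_diagram_eq_diff hc hi i
    have hle := T.le i
    -- A violation forces row `i` to be that of `d`, but not of `c`, with both old parts equal. Then
    -- `d` lies in the inner shape, so `d = c`.
    by_contra! hlt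
    have hid : i = d.1 := by
      by_contra hne
      rw [if_neg hne] at hl
      omega
    obtain ⟨d1, d2, d3, -⟩ := T.outer.corner_spec hd
    rw [if_pos hid] at hl
    have hic : i ≠ c.1 := fun hic => by
      rw [if_pos hic] at hm
      omega
    rw [if_neg hic] at hm
    refine hic (hid.trans (congrArg Prod.fst (h2 ⟨d1, h1.2.1, ?_⟩)))
    rw [← hid] at d3 ⊢
    omega
  · rw [h3, ho, hi]
    simp only [Set.mem_sdiff, Set.mem_singleton_iff]
    tauto

theorem exists_isRectification (T : SkewTableau (Letter B)) : ∃ R, T.IsRectification R := by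
  induction hn : T.inner.diagram.ncard using Nat.strong_induction_on generalizing T with
  | _ n ih =>
    rcases T.inner.diagram.eq_empty_or_nonempty with he | hne
    · exact ⟨T, .refl, T.inner.diagram_eq_empty_iff.1 he⟩
    · obtain ⟨c, hc⟩ := T.inner.exists_corner hne
      obtain ⟨T', hT', hi⟩ := T.exists_isSlide hc
      obtain ⟨R, hR, hR'⟩ := ih _ (by
        rw [← hn, hi]
        exact Set.ncard_sdiff_singleton_lt_of_mem hc.1 T.inner.finite_diagram) T' rfl
      exact ⟨R, .head hT' hR, hR'⟩

end SkewTableau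

theorem mainTheorem4 (lam mu : StrictPartition) (L : SkewTableau (Letter ℕ+))
    (houter : L.outer = lam) (hinner : L.inner = mu) (hL : L.IsQSST) :
    (∃ R, L.phiT.IsRectification R) ∧
    ∀ (R : SkewTableau (Letter (ℕ+ ×ₗ ℕ+))) (nu : StrictPartition),
      L.phiT.IsRectification R → R.outer = nu →
      ∀ j, armOffset lam mu + mu.part 1 + 1 ≤ j → j ≤ lam.part 1 →
        lam.part 1 + 1 ≤ j + nu.part 1 ∧
        R.entry (1, j + nu.part 1 - lam.part 1) = L.phiT.entry (1, j) := by
  subst houter hinner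
  refine ⟨L.phiT.exists_isRectification, ?_⟩
  rintro R nu hR rfl j hj hj'
  obtain ⟨j', h1, h2, h3⟩ := SkewTableau.arm_of_reflTransGen hR.1 (T := L.phiT) hj hj'
  have h1' : j' + L.outer.part 1 = j + R.outer.part 1 := h1
  -- `h2` gives j' ≥ 1, so the natural subtraction in the column index is not truncated.
  refine ⟨by omega, ?_⟩
  rw [← h3, show j + R.outer.part 1 - L.outer.part 1 = j' by omega]
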